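/- **Definitions.** A *cascade* is a partially ordered set $(V,\sqsubseteq)$ with a least element $\varnothing_V$ such that for each $v\in V$ the set $\{s\in V: s\sqsubset v\}$ is well-ordered, and such that each non-empty subset of $V$ has a maximal element. We denote by $\max V$ the set of maximal elements of $V$, by $V^+(v)$ the set of immediate successors of $v$, and $V(v):=\{x\in V: v\sqsubseteq x\}$. The *rank* $r_V(v)$ is $0$ if $v\in\max V$, and otherwise the least ordinal greater than the ranks of all the successors of $v$. The cascade is *sequential* if $V^+(v)$ is countably infinite for each $v\in V\setminus\max V$; a sequential cascade is *monotone* if for each $v\in V\setminus \max V$ the set $V^+(v)$ admits an order of type $\omega$ for which $r_V$ is non-decreasing. The *contour* $\int V(v)$ is the filter on $\max V$ defined inductively: if $v\in\max V$, it is the principal filter of $v$; otherwise $H\in\int V(v)$ if and only if $H\in \int V(x)$ for all but finitely many $x\in V^+(v)$. We write $\int V:=\int V(\varnothing_V)$. Two families of sets *mesh*, $\mathcal A\#\mathcal B$, if $A\cap B\neq\varnothing$ for all $A\in\mathcal A$ and $B\in\mathcal B$; we write $S\#\mathcal B$ for $\{S\}\#\mathcal B$. For filters, $\mathcal F\ge\mathcal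 G$ means $\mathcal F\supseteq\mathcal G$, and $\varphi(\mathcal F)$ is the image filter of $\mathcal F$ under $\varphi$. If $S\subseteq\max V$ and $S\#\int V$, then $V_S$ denotes the set of those $v\in V$ such that $S\#\int V(x)$ for every $x\sqsubseteq v$, with the order induced from $V$. Its maximal elements are maximal in $V$ and belong to $S$, and $\int V_S(v)$ denotes the contour computed in $V_S$, regarded as a filter on $\max V$. **Theorem.** Let $V,W$ be monotone sequential cascades and let $\varphi:\max V\to\max W$ be such that $\varphi(\int V)\ge\int W$. Then there exists a set $T\subseteq\max V$ with $T\#\int V$, infinite unless $V$ is reduced to the single element $\varnothing_V$, such that for each $v\in V_T$ there exists a unique $w(v)\in W$ for which $$\varphi\Big(\int V_T(v)\Big)\ \#\ \int W(w(v)).$$ -/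

import Mathlib

universe u

namespace SeqCascade

/-- Two families of sets mesh, `𝒜 # ℬ`: every member of one meets every member of the other. -/
def Mesh {X : Type*} (𝒜 ℬ : Set (Set X)) : Prop :=
  ∀ A ∈ 𝒜, ∀ B ∈ ℬ, (A ∩ B).Nonempty

/-- A cascade: a tree (the elements below any given element are well-ordered) with a least
element, well-founded for the inverse order. -/
class Cascade (V : Type u) extends PartialOrder V, OrderBot V where
  isWellOrder_below : ∀ v : V, IsWellOrder {s : V // s < v} (fun s t => s < t)
  wellFoundedGT : WellFoundedGT V

instance {V : Type u} [Cascade V] : WellFoundedGT V := Cascade.wellFoundedGT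

section Order

variable {V : Type u} [PartialOrder V]

variable (V) in
/-- The set `max V` of maximal elements, as a type. -/
abbrev MaxElt : Type u := {v : V // IsMax v}

/-- The set `V⁺(v)` of immediate successors of `v`. -/
def succs (v : V) : Set V := {x | v ⋖ x}

/-- The rank of `v`: the least ordinal greater than the ranks of all the successors of `v`
(so it is `0` exactly when `v` is maximal). -/
noncomputable def rank [WellFoundedGT V] (v : V) : Ordinal.{u} := IsWellFounded.rank (fun x y : V => x > y) v

open Classical in
/-- `contour v` is the contour `∫ V(v)` of the cascade `V(v) = {x | v ≤ x}`, as a filter on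
`max V`. It is the principal filter of `v` if `v` is maximal; otherwise it is the contour of the
filters `∫ V(x)`, `x ∈ V⁺(v)`, along the cofinite filter on `V⁺(v)`, that is, a set `H` belongs to
it iff `H ∈ ∫ V(x)` for all but finitely many `x ∈ V⁺(v)`. -/
noncomputable def contour [WellFoundedGT V] (v : V) : Filter (MaxElt V) :=
  if h : IsMax v then pure ⟨v, h⟩
  else Filter.bind (Filter.cofinite : Filter (succs v)) (fun x => contour x.1)
termination_by wellFounded_gt.wrap v
decreasing_by exact x.2.lt

theorem mem_contour_of_not_isMax [WellFoundedGT V] {v : V} (h : ¬ IsMax v) {H : Set (MaxElt V)} :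
    H ∈ contour v ↔ {x : succs v | H ∈ contour x.1}ᶜ.Finite := by
  rw [contour, dif_neg h]
  rfl

/-- `V_S`: the elements `v` of `V` such that `S` meshes `∫ V(x)` for every `x ≤ v`. -/
def restr [WellFoundedGT V] (S : Set (MaxElt V)) : Set V :=
  {v | ∀ x ≤ v, Mesh {S} (contour x).sets}

end Order

section Cascade

variable {V : Type u} [Cascade V]

theorem le_of_lt_of_covBy {v x y : V} (hvx : v ⋖ x) (hyx : y < x) : y ≤ v := by
  have := Cascade.isWellOrder_below x
  rcases trichotomous_of (fun s t : {s : V // s < x} => s < t) ⟨y, hyx⟩ ⟨v, hvx.lt⟩ with h | h | h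
  · exact le_of_lt h
  · exact le_of_eq (congrArg Subtype.val h)
  · exact absurd hyx (hvx.2 h)

/-- The maximal elements of `V_S` are maximal in `V`. -/
theorem isMax_of_isMax_restr (S : Set (MaxElt V)) (v : restr S) (hv : IsMax v) :
    IsMax (v : V) := by
  by_contra hm
  have hS := v.2 v.1 le_rfl
  obtain ⟨x, hx⟩ : ∃ x : succs v.1, Mesh {S} (contour x.1).sets := by
    by_contra hne
    have hc : Sᶜ ∈ contour v.1 := by
      rw [mem_contour_of_not_isMax hm]
      convert Set.finite_empty
      rw [Set.compl_empty_iff, Set.eq_univ_iff_forall]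
      intro x
      by_contra hx
      refine hne ⟨x, ?_⟩
      rintro A rfl B hB
      by_contra hAB
      refine hx (Filter.mem_of_superset hB ?_)
      intro b hb hbA
      exact hAB ⟨b, hbA, hb⟩
    obtain ⟨a, ha, ha'⟩ := hS S rfl _ hc
    exact ha' ha
  have hxm : x.1 ∈ restr S := by
    intro y hy
    rcases hy.eq_or_lt with rfl | hlt
    · exact hx
    · exact v.2 y (le_of_lt_of_covBy x.2 hlt)
  exact x.2.lt.not_ge (hv (b := ⟨x.1, hxm⟩) x.2.le)

/-- The inclusion of `max V_S` in `max V`. -/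
def inclMax (S : Set (MaxElt V)) (v : MaxElt (restr S)) : MaxElt V :=
  ⟨v.1.1, isMax_of_isMax_restr S v.1 v.2⟩

end Cascade

/-- A monotone sequential cascade. -/
structure IsMonotoneSequential (V : Type u) [Cascade V] : Prop where
  /-- Sequential: each non-maximal element has countably infinitely many immediate successors. -/
  countable_succs : ∀ v : V, ¬ IsMax v → (succs v).Countable
  infinite_succs : ∀ v : V, ¬ IsMax v → (succs v).Infinite
  /-- Monotone: the immediate successors of each non-maximal element can be enumerated in
  order type `ω` with non-decreasing ranks. -/
  monotone_rank : ∀ v : V, ¬ IsMax v → ∃ e : ℕ ≃ succs v, Monotone fun n => rank (e n).1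

end SeqCascade

open SeqCascade

/-!
The contour `∫ V_T(v)` computed in `V_T` is the trace of `∫ V(v)` on `T`
(`map_inclMax_contour`). Contours of distinct elements of `W` are disjoint filters
(`disjoint_contour`), so it is enough to find `T` such that, for each `v ∈ V_T`, the filter
`φ(∫ V_T(v))` is *finer* than some `∫ W(w)`: then `w` is the only element whose contour it meshes.

Such a `T` comes from a dichotomy (`exists_convergesAbove_or_disjoint`): each `S` meshing `∫ V(v)`
can be shrunk to a `T` meshing `∫ V(v)` for which either the above holds at every element of `V_T`
over `v`, or `φ(∫ V_T(v))` meshes no contour of `W` at all. At `v = ∅` the second alternative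
contradicts `φ(∫ V) ≥ ∫ W`.

The dichotomy is proved by induction from the immediate successors `c` of `v`. Suitable sets `T c`
are given for infinitely many `c`, and `T` is the union of infinitely many of them.
* If infinitely many `c` are in the second case, then so is `v`. Indeed, countably many filters
  none of which meshes a contour of `W` have a supremum that meshes no contour of `W`
  (`disjoint_iSup_contour`); this is a diagonal argument, by induction in `W`.
* Otherwise infinitely many `c` are in the first case, with limits `u c ∈ W`. By an argument of
  Ramsey type in the tree `W` (`exists_infinite_subset_bind_contour`), there are infinitely many `c`
  along which the contours of the `u c` either converge to a contour of `W`, which gives the first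
  case for `v`, or are separated from each contour of `W`, which gives the second.
-/

namespace SeqCascade

open Filter Set

/-! ### Order structure of a cascade -/

section Order

variable {V : Type u} [Cascade V]

theorem le_or_le_of_le_of_le {a b x : V} (ha : a ≤ x) (hb : b ≤ x) : a ≤ b ∨ b ≤ a := by
  rcases ha.eq_or_lt with rfl | ha
  · exact Or.inr hb
  rcases hb.eq_or_lt with rfl | hb
  · exact Or.inl ha.le
  have := Cascade.isWellOrder_below x
  rcases trichotomous_of (fun s t : {s : V // s < x} => s < t) ⟨a, ha⟩ ⟨b, hb⟩ with h | h | h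
  · exact Or.inl (le_of_lt h)
  · exact Or.inl (le_of_eq (congrArg Subtype.val h))
  · exact Or.inr (le_of_lt h)

theorem exists_mem_succs_le {v x : V} (h : v < x) : ∃ c ∈ succs v, c ≤ x := by
  by_cases hx : v ⋖ x
  · exact ⟨x, hx, le_rfl⟩
  obtain ⟨s, hvs, hsx⟩ : ∃ s, v < s ∧ s < x := by
    by_contra! hne
    exact hx ⟨h, fun s hs hsx => hne s hs hsx⟩
  have := Cascade.isWellOrder_below x
  have hwf : WellFounded (fun s t : {s : V // s < x} => s < t) := IsWellFounded.wf
  obtain ⟨c, hvc, hmin⟩ := hwf.has_min {t : {s : V // s < x} | v < t.1} ⟨⟨s, hsx⟩, hvs⟩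
  exact ⟨c.1, ⟨hvc, fun t hvt htc => hmin ⟨t, htc.trans c.2⟩ hvt htc⟩, c.2.le⟩

theorem eq_of_mem_succs_of_le {v c d x : V} (hc : c ∈ succs v) (hd : d ∈ succs v)
    (hcx : c ≤ x) (hdx : d ≤ x) : c = d := by
  rcases le_or_le_of_le_of_le hcx hdx with h | h
  · exact h.eq_of_not_lt fun hlt => hd.2 hc.lt hlt
  · exact (h.eq_of_not_lt fun hlt => hc.2 hd.lt hlt).symm

/-- The set `max V(v)` of the maximal elements of `V` that lie above `v`. -/
def cone (v : V) : Set (MaxElt V) := {m | v ≤ m.1}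

theorem cone_anti {v x : V} (h : v ≤ x) : cone x ⊆ cone v := fun _ hm => h.trans hm

theorem disjoint_cone {v x : V} (h₁ : ¬ v ≤ x) (h₂ : ¬ x ≤ v) : Disjoint (cone v) (cone x) :=
  Set.disjoint_left.2 fun _ hv hx => (le_or_le_of_le_of_le hv hx).elim h₁ h₂

end Order

/-! ### Contours -/

section Contour

variable {V : Type u} [Cascade V]

theorem contour_of_isMax {v : V} (h : IsMax v) : contour v = pure ⟨v, h⟩ := by
  rw [contour, dif_pos h]

theorem contour_of_not_isMax {v : V} (h : ¬ IsMax v) :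
    contour v = Filter.bind cofinite fun x : succs v => contour x.1 := by
  rw [contour, dif_neg h]

theorem mem_contour_iff_eventually {v : V} (h : ¬ IsMax v) {H : Set (MaxElt V)} :
    H ∈ contour v ↔ ∀ᶠ c : succs v in cofinite, H ∈ contour c.1 :=
  mem_contour_of_not_isMax h

theorem frequently_contour_iff {v : V} (h : ¬ IsMax v) {S : Set (MaxElt V)} :
    (∃ᶠ m in contour v, m ∈ S) ↔
      ∃ᶠ c : succs v in cofinite, ∃ᶠ m in contour c.1, m ∈ S := by
  simp only [Filter.Frequently, not_not]
  exact not_congr (mem_contour_iff_eventually h)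

theorem cone_mem_contour_self (v : V) : cone v ∈ contour v := by
  induction v using WellFoundedGT.induction with
  | _ v ih =>
    by_cases h : IsMax v
    · rw [contour_of_isMax h]
      exact le_rfl (a := v)
    · rw [mem_contour_iff_eventually h]
      exact Eventually.of_forall fun c =>
        mem_of_superset (ih c.1 c.2.lt) (cone_anti c.2.le)

theorem cone_mem_contour {v x : V} (h : v ≤ x) : cone v ∈ contour x :=
  mem_of_superset (cone_mem_contour_self x) (cone_anti h)

theorem compl_cone_mem_contour {v x : V} (h : x < v) : (cone v)ᶜ ∈ contour x := by
  obtain ⟨c, hc, hcv⟩ := exists_mem_succs_le h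
  rw [mem_contour_iff_eventually h.not_isMax]
  refine (finite_singleton (⟨c, hc⟩ : succs x)).subset fun d hd => ?_
  by_contra hne
  refine hd (mem_of_superset (cone_mem_contour_self d.1) fun m hdm hvm => hne ?_)
  exact Subtype.ext (eq_of_mem_succs_of_le d.2 hc hdm (hcv.trans hvm))

theorem disjoint_contour {v x : V} (h : v ≠ x) : Disjoint (contour v) (contour x) := by
  by_cases h₁ : v ≤ x
  · exact Filter.disjoint_of_disjoint_of_mem disjoint_compl_left
      (compl_cone_mem_contour (h₁.lt_of_ne h)) (cone_mem_contour_self x)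
  by_cases h₂ : x ≤ v
  · exact Filter.disjoint_of_disjoint_of_mem disjoint_compl_right
      (cone_mem_contour_self v) (compl_cone_mem_contour (h₂.lt_of_ne h.symm))
  exact Filter.disjoint_of_disjoint_of_mem (disjoint_cone h₁ h₂)
    (cone_mem_contour_self v) (cone_mem_contour_self x)

theorem contour_neBot (hV : ∀ v : V, ¬ IsMax v → (succs v).Infinite) (v : V) :
    (contour v).NeBot := by
  induction v using WellFoundedGT.induction with
  | _ v ih =>
    by_cases h : IsMax v
    · rw [contour_of_isMax h]
      infer_instance
    · have := (hV v h).to_subtype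
      refine neBot_iff.2 fun hbot => ?_
      have hemp := (mem_contour_iff_eventually h).1 (empty_mem_iff_bot.2 hbot)
      obtain ⟨c, hc⟩ := hemp.exists
      exact (ih c.1 c.2.lt).ne (empty_mem_iff_bot.1 hc)

theorem compl_singleton_mem_contour {v : V} (h : ¬ IsMax v) (m : MaxElt V) :
    {m}ᶜ ∈ contour v := by
  by_cases hm : v ≤ m.1
  · have hlt : v < m.1 := hm.lt_of_ne fun he => h (he ▸ m.2)
    refine mem_of_superset (compl_cone_mem_contour hlt) (compl_subset_compl.2 ?_)
    exact singleton_subset_iff.2 (le_rfl (a := m.1))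
  · refine mem_of_superset (cone_mem_contour_self v) fun m' hm' he => hm ?_
    rw [← mem_singleton_iff.1 he]
    exact hm'

theorem infinite_of_frequently_contour {v : V} (h : ¬ IsMax v) {T : Set (MaxElt V)}
    (hT : ∃ᶠ m in contour v, m ∈ T) : T.Infinite := by
  intro hfin
  refine hT ?_
  have : Tᶜ = ⋂ m ∈ T, {m}ᶜ := by
    rw [← compl_iUnion₂, biUnion_of_singleton]
  change Tᶜ ∈ contour v
  rw [this, biInter_mem hfin]
  exact fun m _ => compl_singleton_mem_contour h m

end Contour

/-! ### Meshing, and the contours of a restricted cascade -/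

section Restr

theorem mesh_sets_iff {X : Type*} {F G : Filter X} :
    Mesh F.sets G.sets ↔ ¬ Disjoint F G := by
  rw [Filter.disjoint_iff]
  simp only [Mesh, Filter.mem_sets, Set.disjoint_iff_inter_eq_empty, not_exists, not_and,
    Set.nonempty_iff_ne_empty, ne_eq]

theorem mesh_singleton_iff {X : Type*} {S : Set X} {F : Filter X} :
    Mesh {S} F.sets ↔ ∃ᶠ x in F, x ∈ S := by
  rw [Filter.frequently_iff]
  constructor
  · intro h U hU
    obtain ⟨x, hx, hx'⟩ := h S rfl U hU
    exact ⟨x, hx', hx⟩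
  · rintro h A rfl B hB
    obtain ⟨x, hx, hx'⟩ := h hB
    exact ⟨x, hx', hx⟩

variable {V : Type u} [Cascade V]

theorem mem_restr_iff {T : Set (MaxElt V)} {v : V} :
    v ∈ restr T ↔ ∀ x ≤ v, ∃ᶠ m in contour x, m ∈ T :=
  forall₂_congr fun _ _ => mesh_singleton_iff

theorem mem_restr_of_mem_succs {T : Set (MaxElt V)} {v c : V} (hv : v ∈ restr T)
    (hc : c ∈ succs v) (hT : ∃ᶠ m in contour c, m ∈ T) : c ∈ restr T := by
  refine mem_restr_iff.2 fun x hx => ?_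
  rcases hx.eq_or_lt with rfl | hlt
  · exact hT
  · exact mem_restr_iff.1 hv x (le_of_lt_of_covBy hc hlt)

theorem covBy_restr_iff {T : Set (MaxElt V)} {v c : restr T} : v ⋖ c ↔ v.1 ⋖ c.1 := by
  constructor
  · intro h
    refine ⟨h.lt, fun x hvx hxc => ?_⟩
    exact h.2 (c := ⟨x, fun y hy => c.2 y (hy.trans hxc.le)⟩) hvx hxc
  · exact fun h => ⟨h.lt, fun x hvx hxc => h.2 hvx hxc⟩

/-- The contour computed in `V_T` is the trace on `T` of the contour computed in `V`. -/
theorem map_inclMax_contour (T : Set (MaxElt V)) (v : restr T) :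
    map (inclMax T) (contour v) = contour v.1 ⊓ 𝓟 T := by
  induction v using WellFoundedGT.induction with
  | _ v ih =>
    by_cases h : IsMax v
    · have hv := isMax_of_isMax_restr T v h
      have hT : (⟨v.1, hv⟩ : MaxElt V) ∈ T := by
        have := mem_restr_iff.1 v.2 v.1 le_rfl
        rwa [contour_of_isMax hv, frequently_pure] at this
      rw [contour, dif_pos h, contour_of_isMax hv, map_pure, inf_of_le_left]
      · rfl
      · exact le_principal_iff.2 hT
    · have hv : ¬ IsMax v.1 := fun hm => h fun x hx => hm hx
      ext H
      rw [mem_map, mem_contour_of_not_isMax h, mem_inf_principal, mem_contour_of_not_isMax hv]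
      -- a successor outside `V_T` does not matter, because `Tᶜ` belongs to its contour
      let i : succs v → succs v.1 := fun c => ⟨c.1.1, covBy_restr_iff.1 c.2⟩
      have hi : i.Injective := fun a b hab =>
        Subtype.ext (Subtype.ext (congrArg (fun z : succs v.1 => z.1) hab))
      have hmem : ∀ c : succs v, inclMax T ⁻¹' H ∈ contour c.1 ↔
          {m | m ∈ T → m ∈ H} ∈ contour (i c).1 := fun c => by
        rw [← mem_map, ih c.1 c.2.lt, mem_inf_principal]
      have himage : {c : succs v.1 | {m | m ∈ T → m ∈ H} ∈ contour c.1}ᶜ =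
          i '' {c : succs v | inclMax T ⁻¹' H ∈ contour c.1}ᶜ := by
        ext c
        constructor
        · intro hc
          have hcT : ∃ᶠ m in contour c.1, m ∈ T := fun hn =>
            hc (mem_of_superset hn fun m hm hmT => absurd hmT hm)
          refine ⟨⟨⟨c.1, mem_restr_of_mem_succs v.2 c.2 hcT⟩, covBy_restr_iff.2 c.2⟩, ?_, rfl⟩
          exact fun hc' => hc ((hmem _).1 hc')
        · rintro ⟨d, hd, rfl⟩
          exact fun hd' => hd ((hmem d).2 hd')
      rw [himage, finite_image_iff hi.injOn]

end Restr

/-! ### Separating filters from contours -/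

section Separation

variable {W : Type u} [Cascade W]

/-- For filters that avoid every contour above `w`, separation from `contour w` can be achieved
uniformly over a countable family. -/
theorem disjoint_iSup_contour (hW : ∀ w : W, ¬ IsMax w → (succs w).Countable)
    {ι : Type*} [Countable ι] (F : ι → Filter (MaxElt W)) (w : W)
    (hF : ∀ w', w ≤ w' → ∀ j, Disjoint (F j) (contour w')) :
    Disjoint (⨆ j, F j) (contour w) := by
  induction w using WellFoundedGT.induction with
  | _ w ih =>
    by_cases h : IsMax w
    · have := hF w le_rfl
      rw [contour_of_isMax h] at this ⊢
      simp only [← principal_singleton, disjoint_principal_right] at this ⊢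
      exact mem_iSup.2 this
    have hsep : ∀ {G₁ G₂ : Filter (MaxElt W)}, Disjoint G₁ G₂ ↔ ∃ s ∈ G₂, sᶜ ∈ G₁ := by
      intro G₁ G₂
      rw [Filter.disjoint_iff]
      constructor
      · rintro ⟨s, hs, t, ht, hst⟩
        exact ⟨t, ht, mem_of_superset hs hst.subset_compl_right⟩
      · rintro ⟨s, hs, hs'⟩
        exact ⟨sᶜ, hs', s, hs, disjoint_compl_left⟩
    simp only [hsep, mem_iSup] at ih ⊢
    choose G hG hGF using fun c : succs w => ih c.1 c.2.lt fun w' hw' j =>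
      hsep.1 (hF w' (c.2.le.trans hw') j)
    choose E hE hEF using fun j => hsep.1 (hF w le_rfl j)
    have := (hW w h).to_subtype
    obtain ⟨f, hf⟩ := exists_injective_nat (succs w)
    obtain ⟨g, hg⟩ := exists_injective_nat ι
    -- the `c`-th part is cut down by the finitely many `E j` with `g j ≤ f c` that are large at `c`
    refine ⟨⋃ c : succs w, G c ∩ ⋂ j ∈ {j | g j ≤ f c ∧ E j ∈ contour c.1}, E j, ?_, ?_⟩
    · rw [mem_contour_iff_eventually h]
      refine Eventually.of_forall fun c => mem_of_superset (inter_mem (hG c) ?_)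
        (subset_iUnion (fun c : succs w =>
          G c ∩ ⋂ j ∈ {j | g j ≤ f c ∧ E j ∈ contour c.1}, E j) c)
      have hfin : {j | g j ≤ f c ∧ E j ∈ contour c.1}.Finite :=
        ((finite_Iic (f c)).preimage hg.injOn).subset fun j hj => hj.1
      exact (biInter_mem hfin).2 fun j hj => hj.2
    · intro j
      have hfin : {c : succs w | f c < g j ∨ E j ∉ contour c.1}.Finite :=
        ((finite_Iio (g j)).preimage hf.injOn).union
          ((mem_contour_iff_eventually h).1 (hE j))
      refine mem_of_superset (inter_mem (hEF j) ((biInter_mem hfin).2 fun c _ => hGF c j)) ?_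
      rintro m ⟨hmE, hmG⟩ hm
      obtain ⟨c, hmc, hmc'⟩ := mem_iUnion.1 hm
      by_cases hc : g j ≤ f c ∧ E j ∈ contour c.1
      · exact hmE (mem_iInter₂.1 hmc' j hc)
      · refine mem_iInter₂.1 hmG c ?_ hmc
        by_contra hc'
        exact hc ⟨not_lt.1 fun hlt => hc' (Or.inl hlt), not_not.1 fun hn => hc' (Or.inr hn)⟩

/-- Every infinite family of elements of `W` has an infinite subfamily along which the contours
either converge to the contour of some element or stay away from all contours. -/
theorem exists_infinite_subset_bind_contour {α : Type*} (u : α → W) {J : Set α}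
    (hJ : J.Infinite) :
    ∃ J' ⊆ J, J'.Infinite ∧
      ((∃ w, Filter.bind (cofinite ⊓ 𝓟 J') (fun c => contour (u c)) ≤ contour w) ∨
        ∀ w, Disjoint (Filter.bind (cofinite ⊓ 𝓟 J') fun c => contour (u c)) (contour w)) := by
  have hmem : ∀ {J' : Set α} {H : Set (MaxElt W)}, {c ∈ J' | H ∉ contour (u c)}.Finite →
      H ∈ Filter.bind (cofinite ⊓ 𝓟 J') fun c => contour (u c) := by
    intro J' H hfin
    change {c | H ∈ contour (u c)} ∈ cofinite ⊓ 𝓟 J'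
    rw [mem_inf_principal]
    refine hfin.subset fun c hc => ?_
    simpa using hc
  -- `w` is the last node above which infinitely many terms of the family lie
  obtain ⟨w, hw, hmax⟩ := wellFounded_gt.has_min {w : W | {c ∈ J | w ≤ u c}.Infinite}
    ⟨⊥, by simpa using hJ⟩
  have hfin : ∀ d, w < d → {c ∈ J | d ≤ u c}.Finite := fun d hd =>
    not_infinite.1 fun hinf => hmax d hinf hd
  -- constantly `w`: the limit is `w`
  by_cases h₁ : {c ∈ J | u c = w}.Infinite
  · refine ⟨_, sep_subset _ _, h₁, Or.inl ⟨w, fun H hH => hmem ?_⟩⟩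
    convert finite_empty
    refine eq_empty_of_forall_notMem fun c hc => hc.2 ?_
    rw [hc.1.2]
    exact hH
  -- immediate successors of `w`, each taken finitely often by `hfin`: the limit is again `w`
  by_cases h₂ : {c ∈ J | u c ∈ succs w}.Infinite
  · refine ⟨_, sep_subset _ _, h₂, Or.inl ⟨w, fun H hH => hmem ?_⟩⟩
    obtain ⟨c₀, -, hc₀⟩ := h₂.nonempty
    have hH' := mem_contour_of_not_isMax hc₀.lt.not_isMax |>.1 hH
    refine (hH'.biUnion fun d _ => hfin d.1 d.2.lt).subset fun c hc => ?_
    exact mem_iUnion₂.2 ⟨⟨u c, hc.1.2⟩, hc.2, hc.1.1, le_rfl⟩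
  -- what remains lies strictly above immediate successors of `w`, and finitely many terms above
  -- each of these; no element of `W` is then a limit
  have h₃ : {c ∈ J | w < u c ∧ u c ∉ succs w}.Infinite := by
    intro h₃
    refine hw (((not_infinite.1 h₁).union (not_infinite.1 h₂)).union h₃ |>.subset ?_)
    intro c hc
    rcases hc.2.eq_or_lt with he | hlt
    · exact Or.inl (Or.inl ⟨hc.1, he.symm⟩)
    · by_cases hs : u c ∈ succs w
      · exact Or.inl (Or.inr ⟨hc.1, hs⟩)
      · exact Or.inr ⟨hc.1, hlt, hs⟩
  refine ⟨_, sep_subset _ _, h₃, Or.inr fun w' => ?_⟩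
  have hout : ∀ H, Hᶜ ∈ contour w' → {c ∈ {c ∈ J | w < u c ∧ u c ∉ succs w} |
      H ∉ contour (u c)}.Finite → Disjoint (Filter.bind
        (cofinite ⊓ 𝓟 {c ∈ J | w < u c ∧ u c ∉ succs w}) fun c => contour (u c)) (contour w') :=
    fun H hH hHf => Filter.disjoint_of_disjoint_of_mem disjoint_compl_right (hmem hHf) hH
  by_cases hlt : w < w'
  · obtain ⟨d, hd, hdw'⟩ := exists_mem_succs_le hlt
    refine hout (cone w')ᶜ (by simpa using cone_mem_contour_self w') ?_
    refine (hfin d hd.lt).subset fun c hc => ⟨hc.1.1, ?_⟩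
    by_contra hdc
    refine hc.2 (mem_of_superset (cone_mem_contour_self (u c)) ?_)
    refine ((disjoint_cone hdc fun hcd => ?_).mono_left (cone_anti hdw')).subset_compl_left
    exact hd.2 hc.1.2.1 (lt_of_le_of_ne hcd fun he => hdc he.ge)
  by_cases heq : w' = w
  · subst heq
    refine hout (⋃ c ∈ {c ∈ J | w' < u c ∧ u c ∉ succs w'}, cone (u c)) ?_ ?_
    · obtain ⟨c₀, -, hc₀, -⟩ := h₃.nonempty
      rw [mem_contour_iff_eventually hc₀.not_isMax]
      refine Eventually.of_forall fun d => ?_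
      have hd : {c ∈ J | (w' < u c ∧ u c ∉ succs w') ∧ d.1 ≤ u c}.Finite :=
        (hfin d.1 d.2.lt).subset fun c hc => ⟨hc.1, hc.2.2⟩
      refine mem_of_superset (inter_mem (cone_mem_contour_self d.1)
        ((biInter_mem hd).2 fun c hc => compl_cone_mem_contour (v := u c)
          (hc.2.2.lt_of_ne fun he => hc.2.1.2 (he ▸ d.2)))) ?_
      rintro m ⟨hmd, hm⟩ hm'
      obtain ⟨c, hc, hmc⟩ := mem_iUnion₂.1 hm'
      refine mem_iInter₂.1 hm c ⟨hc.1, hc.2, ?_⟩ hmc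
      rcases le_or_le_of_le_of_le hmd hmc with hle | hle
      · exact hle
      · exact (hle.eq_of_not_lt fun hlt => d.2.2 hc.2.1 hlt).ge
    · convert finite_empty
      refine eq_empty_of_forall_notMem fun c hc => hc.2 ?_
      exact mem_of_superset (cone_mem_contour_self (u c))
        (subset_biUnion_of_mem (u := fun c => cone (u c)) hc.1)
  · -- here `w'` is below `w` or incomparable with it
    refine hout (cone w) ?_ ?_
    · by_cases hlt' : w' < w
      · exact compl_cone_mem_contour hlt'
      · refine mem_of_superset (cone_mem_contour_self w') ?_
        exact (disjoint_cone (fun hle => hlt (hle.lt_of_ne (Ne.symm heq)))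
          fun hle => hlt' (hle.lt_of_ne heq)).subset_compl_left
    · convert finite_empty
      exact eq_empty_of_forall_notMem fun c hc => hc.2 (cone_mem_contour hc.1.2.1.le)

end Separation

/-! ### Images of contours: the dichotomy -/

section Dichotomy

universe u'

variable {V : Type u} {W : Type u'} [Cascade V] [Cascade W]

/-- The image under `φ` of the trace on `T` of the contour of `v`. -/
noncomputable def imageContour (φ : MaxElt V → MaxElt W) (T : Set (MaxElt V)) (v : V) :
    Filter (MaxElt W) :=
  map φ (contour v ⊓ 𝓟 T)

/-- At each element of `V_T` above `v`, the image of the contour of `V_T` is finer than the contour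
of some element of `W`. Membership in `V_T` is taken relative to the cascade `V(v)`: only the
elements between `v` and the given one are tested. -/
def ConvergesAbove (φ : MaxElt V → MaxElt W) (T : Set (MaxElt V)) (v : V) : Prop :=
  ∀ x, v ≤ x → (∀ y, v ≤ y → y ≤ x → ∃ᶠ m in contour y, m ∈ T) →
    ∃ w, imageContour φ T x ≤ contour w

section Glue

variable {v : V} {T : succs v → Set (MaxElt V)} {J : Set (succs v)}

theorem biUnion_inter_cone (hT : ∀ c, T c ⊆ cone c.1) {c : succs v} (hc : c ∈ J) :
    (⋃ d ∈ J, T d) ∩ cone c.1 = T c := by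
  refine Subset.antisymm ?_ (subset_inter (subset_biUnion_of_mem (u := T) hc) (hT c))
  rintro m ⟨hm, hmc⟩
  obtain ⟨d, -, hmd⟩ := mem_iUnion₂.1 hm
  obtain rfl : d = c := Subtype.ext (eq_of_mem_succs_of_le d.2 c.2 (hT d hmd) hmc)
  exact hmd

theorem contour_inf_principal_biUnion (hT : ∀ c, T c ⊆ cone c.1) {c : succs v} (hc : c ∈ J)
    {x : V} (hx : c.1 ≤ x) :
    contour x ⊓ 𝓟 (⋃ d ∈ J, T d) = contour x ⊓ 𝓟 (T c) := by
  rw [← biUnion_inter_cone hT hc, ← inf_principal, inf_comm (𝓟 _) (𝓟 (cone c.1)), ← inf_assoc,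
    inf_of_le_left (a := contour x) (le_principal_iff.2 (cone_mem_contour hx))]

/-- The union of the `T d`, `d ∈ J`, meshes no contour of a successor outside `J`. -/
theorem mem_of_frequently_biUnion (hT : ∀ c, T c ⊆ cone c.1) {c : succs v}
    (h : ∃ᶠ m in contour c.1, m ∈ ⋃ d ∈ J, T d) : c ∈ J := by
  obtain ⟨m, hm, hmc⟩ := (h.and_eventually (cone_mem_contour_self c.1)).exists
  obtain ⟨d, hd, hmd⟩ := mem_iUnion₂.1 hm
  obtain rfl : d = c := Subtype.ext (eq_of_mem_succs_of_le d.2 c.2 (hT d hmd) hmc)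
  exact hd

theorem frequently_contour_biUnion (hv : ¬ IsMax v) (hJ : J.Infinite)
    (h : ∀ c ∈ J, ∃ᶠ m in contour c.1, m ∈ T c) :
    ∃ᶠ m in contour v, m ∈ ⋃ d ∈ J, T d := by
  rw [frequently_contour_iff hv, frequently_cofinite_iff_infinite]
  refine hJ.mono fun c hc => (h c hc).mono fun m hm => ?_
  exact mem_iUnion₂.2 ⟨c, hc, hm⟩

theorem imageContour_biUnion_le (hv : ¬ IsMax v) (φ : MaxElt V → MaxElt W)
    (hT : ∀ c, T c ⊆ cone c.1) :
    imageContour φ (⋃ d ∈ J, T d) v ≤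
      Filter.bind (cofinite ⊓ 𝓟 J) fun c => imageContour φ (T c) c.1 := by
  intro H hH
  have hH' : {c | H ∈ imageContour φ (T c) c.1} ∈ cofinite ⊓ 𝓟 J := hH
  rw [mem_inf_principal] at hH'
  rw [imageContour, mem_map, mem_inf_principal, mem_contour_iff_eventually hv]
  filter_upwards [hH'] with c hc
  rw [← mem_inf_principal]
  by_cases hcJ : c ∈ J
  · rw [contour_inf_principal_biUnion hT hcJ le_rfl]
    exact hc hcJ
  · rw [mem_inf_principal]
    by_contra hn
    exact hcJ (mem_of_frequently_biUnion hT fun hf =>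
      hn (mem_of_superset hf fun m hm hmT => absurd hmT hm))

end Glue

/-- Any set that meshes `∫ V(v)` shrinks to a meshing set `T` such that the images of the contours
of `V_T` are finer than contours of `W` throughout `V_T(v)`, or else the image of `∫ V_T(v)` meshes
no contour of `W`. -/
theorem exists_convergesAbove_or_disjoint
    (hV : ∀ v : V, ¬ IsMax v → (succs v).Countable)
    (hW : ∀ w : W, ¬ IsMax w → (succs w).Countable)
    (φ : MaxElt V → MaxElt W) (v : V) (S : Set (MaxElt V)) (hS : ∃ᶠ m in contour v, m ∈ S) :
    ∃ T ⊆ S, (∃ᶠ m in contour v, m ∈ T) ∧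
      (ConvergesAbove φ T v ∨ ∀ w, Disjoint (imageContour φ T v) (contour w)) := by
  induction v using WellFoundedGT.induction generalizing S with
  | _ v ih =>
    by_cases h : IsMax v
    · refine ⟨S, Subset.rfl, hS, Or.inl fun x hx _ => ⟨(φ ⟨v, h⟩).1, ?_⟩⟩
      obtain rfl := h.eq_of_le hx
      rw [contour_of_isMax (φ ⟨v, h⟩).2, imageContour, contour_of_isMax h]
      exact map_mono inf_le_left
    have hI := frequently_cofinite_iff_infinite.1 ((frequently_contour_iff h).1 hS)
    set I := {c : succs v | ∃ᶠ m in contour c.1, m ∈ S} with hI_def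
    have hex : ∀ c : succs v, ∃ T ⊆ S ∩ cone c.1, c ∈ I → (∃ᶠ m in contour c.1, m ∈ T) ∧
        (ConvergesAbove φ T c.1 ∨ ∀ w, Disjoint (imageContour φ T c.1) (contour w)) := by
      intro c
      by_cases hc : c ∈ I
      · obtain ⟨T, hT, hT'⟩ := ih c.1 c.2.lt (S ∩ cone c.1)
          (Frequently.and_eventually hc (cone_mem_contour_self c.1))
        exact ⟨T, hT, fun _ => hT'⟩
      · exact ⟨∅, empty_subset _, fun hc' => absurd hc' hc⟩
    choose T hTS hT using hex
    have hTc : ∀ c, T c ⊆ cone c.1 := fun c => (hTS c).trans inter_subset_right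
    have hsub : ∀ J : Set (succs v), ⋃ c ∈ J, T c ⊆ S := fun J =>
      iUnion₂_subset fun c _ => (hTS c).trans inter_subset_left
    have hfreq : ∀ J ⊆ I, J.Infinite → ∃ᶠ m in contour v, m ∈ ⋃ c ∈ J, T c := fun J hJI hJ =>
      frequently_contour_biUnion h hJ fun c hc => (hT c (hJI hc)).1
    by_cases hbad : {c ∈ I | ∀ w, Disjoint (imageContour φ (T c) c.1) (contour w)}.Infinite
    · refine ⟨_, hsub _, hfreq _ (sep_subset _ _) hbad, Or.inr fun w => ?_⟩
      set J := {c ∈ I | ∀ w, Disjoint (imageContour φ (T c) c.1) (contour w)}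
      have := (hV v h).to_subtype
      refine (disjoint_iSup_contour hW (fun c : J => imageContour φ (T c.1) c.1.1) w
        fun w' _ c => c.2.2 w').mono_left ((imageContour_biUnion_le h φ hTc).trans ?_)
      intro H hH
      change {c | H ∈ imageContour φ (T c) c.1} ∈ cofinite ⊓ 𝓟 J
      exact mem_inf_of_right fun c hc => mem_iSup.1 hH ⟨c, hc⟩
    have hgood : {c ∈ I | ConvergesAbove φ (T c) c.1}.Infinite := fun hfin =>
      hI (((not_infinite.1 hbad).union hfin).subset fun c hc =>
        (hT c hc).2.elim (fun h' => Or.inr ⟨hc, h'⟩) fun h' => Or.inl ⟨hc, h'⟩)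
    have hlim : ∀ c : succs v, ∃ w : W, c ∈ {c ∈ I | ConvergesAbove φ (T c) c.1} →
        imageContour φ (T c) c.1 ≤ contour w := by
      intro c
      by_cases hc : c ∈ {c ∈ I | ConvergesAbove φ (T c) c.1}
      · obtain ⟨w, hw⟩ := hc.2 c.1 le_rfl fun y hy hy' => le_antisymm hy hy' ▸ (hT c hc.1).1
        exact ⟨w, fun _ => hw⟩
      · exact ⟨⊥, fun hc' => absurd hc' hc⟩
    choose u hu using hlim
    obtain ⟨J, hJsub, hJ, hcase⟩ := exists_infinite_subset_bind_contour u hgood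
    have hle : imageContour φ (⋃ c ∈ J, T c) v ≤
        Filter.bind (cofinite ⊓ 𝓟 J) fun c => contour (u c) := by
      refine (imageContour_biUnion_le h φ hTc).trans fun H hH => ?_
      have hH' : {c | H ∈ contour (u c)} ∈ cofinite ⊓ 𝓟 J := hH
      change {c | H ∈ imageContour φ (T c) c.1} ∈ cofinite ⊓ 𝓟 J
      filter_upwards [hH', mem_inf_of_right (mem_principal_self J)] with c hc hcJ
      exact hu c (hJsub hcJ) hc
    refine ⟨_, hsub J, hfreq J (fun c hc => (hJsub hc).1) hJ, ?_⟩
    rcases hcase with ⟨w, hw⟩ | hw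
    · refine Or.inl fun x hvx hx => ?_
      rcases hvx.eq_or_lt with rfl | hlt
      · exact ⟨w, hle.trans hw⟩
      obtain ⟨c, hc, hcx⟩ := exists_mem_succs_le hlt
      have hcJ : (⟨c, hc⟩ : succs v) ∈ J := mem_of_frequently_biUnion hTc (hx c hc.le hcx)
      have htrace : ∀ y, c ≤ y → contour y ⊓ 𝓟 (⋃ d ∈ J, T d) = contour y ⊓ 𝓟 (T ⟨c, hc⟩) :=
        fun y hy => contour_inf_principal_biUnion hTc hcJ hy
      rw [imageContour, htrace x hcx]
      refine (hJsub hcJ).2 x hcx fun y hcy hyx => ?_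
      have hy := hx y (hc.le.trans hcy) hyx
      rwa [frequently_mem_iff_neBot, htrace y hcy, ← frequently_mem_iff_neBot] at hy
    · exact Or.inr fun w => (hw w).mono_left hle

end Dichotomy

end SeqCascade

open SeqCascade
theorem mainTheorem4 {V : Type*} {W : Type*} [Cascade V] [Cascade W]
    (hV : IsMonotoneSequential V) (hW : IsMonotoneSequential W)
    (φ : MaxElt V → MaxElt W)
    (hφ : Filter.map φ (contour (⊥ : V)) ≤ contour (⊥ : W)) :
    ∃ T : Set (MaxElt V),
      Mesh {T} (contour (⊥ : V)).sets ∧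
      (¬ IsMax (⊥ : V) → T.Infinite) ∧
      ∀ v : restr T, ∃! w : W,
        Mesh (Filter.map φ (Filter.map (inclMax T) (contour v))).sets (contour w).sets := by
  have := contour_neBot hV.infinite_succs (⊥ : V)
  obtain ⟨T, -, hT, hcase⟩ := exists_convergesAbove_or_disjoint hV.countable_succs
    hW.countable_succs φ ⊥ Set.univ (by simpa using this)
  have hne : ∀ x : V, (∃ᶠ m in contour x, m ∈ T) → (imageContour φ T x).NeBot := fun x hx =>
    Filter.NeBot.map (Filter.frequently_mem_iff_neBot.1 hx) φ
  have hconv : ConvergesAbove φ T ⊥ := by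
    refine hcase.resolve_right fun hdisj => (hne ⊥ hT).ne ?_
    exact (hdisj ⊥).eq_bot_of_le ((Filter.map_mono inf_le_left).trans hφ)
  refine ⟨T, mesh_singleton_iff.2 hT, fun h => infinite_of_frequently_contour h hT, fun v => ?_⟩
  have hv := mem_restr_iff.1 v.2
  obtain ⟨w, hw⟩ := hconv v.1 bot_le fun y _ hy => hv y hy
  have hnev := hne v.1 (hv v.1 le_rfl)
  rw [map_inclMax_contour]
  refine ⟨w, mesh_sets_iff.2 fun hdisj => hnev.ne (hdisj.eq_bot_of_le hw), fun w' hw' => ?_⟩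
  by_contra hww'
  exact mesh_sets_iff.1 hw' ((disjoint_contour (Ne.symm hww')).mono_left hw)
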